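/- Let $N\ge 1$ be an integer, $\alpha\in\mathbb{Z}/N\mathbb{Z}$, $R=\mathbb{Z}[X]/(X^N-1)$, and let $\mathcal{P}(N;\alpha)$ be the set of primes $p\equiv\alpha\pmod N$. For $n\ge 1$ put \[\mathcal{A}_n(N;\alpha)=\Bigl(\prod_{p\in\mathcal{P}(N;\alpha)}R/p^nR\Bigr)\Big/\Bigl(\bigoplus_{p\in\mathcal{P}(N;\alpha)}R/p^nR\Bigr),\qquad \widehat{\mathcal{A}}(N;\alpha)=\varprojlim_n\mathcal{A}_n(N;\alpha),\] with the projective limit topology of the discrete rings $\mathcal{A}_n(N;\alpha)$, and let $\pi_N\colon\prod_{p\in\mathcal{P}(N;\alpha)}\varprojlim_n R/p^nR\to\widehat{\mathcal{A}}(N;\alpha)$ be the natural projection. The ring $\widehat{\mathcal{A}}(N;\alpha)$ is a $\mathbb{Q}$-algebra. Put $\boldsymbol{p}=\pi_N((p)_p)$. Let $\mu_N$ be the group of $N$-th roots of unity in $\mathbb{C}$, embedded in $R^\times$ by sending a fixed primitive $N$-th root of unity to the class of $X$, and put $\eta^{\boldsymbol{p}}=\pi_N((\eta^p)_p)$ for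 $\eta\in\mu_N$. For $\eta_1,\dots,\eta_r\in\mu_N$ and positive integers $k_1,\dots,k_r$ ($r\ge 0$) the $\boldsymbol{p}$-adic finite multiple $L$-value is \[L_{\widehat{\mathcal{A}},\alpha}\binom{\eta_1,\dots,\eta_r}{k_1,\dots,k_r}=\pi_N\Biggl(\Biggl(\sum_{0<n_1<\cdots<n_r<p}\frac{\eta_1^{n_1}\eta_2^{n_2-n_1}\cdots\eta_r^{n_r-n_{r-1}}}{n_1^{k_1}\cdots n_r^{k_r}}\Biggr)_{p}\Biggr)\in\widehat{\mathcal{A}}(N;\alpha).\] It is extended $\mathbb{Q}$-linearly to the $\mathbb{Q}$-vector space $\mathcal{R}_N$ with basis the tuples $\binom{\eta_1,\dots,\eta_r}{k_1,\dots,k_r}$. The shuffle product on $\mathcal{R}_N$ is $a\mathbin{\sqcup\!\sqcup} b=W^{-1}(W(a)\mathbin{\sqcup\!\sqcup} W(b))$, where $W$ is the linear bijection $\binom{\eta_1,\dots,\eta_r}{k_1,\dots,k_r}\mapsto\prod_{i=1}^r e_{\eta_i}e_0^{k_i-1}$ from $\mathcal{R}_N$ onto the span of the words in the letters $e_0$,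 $e_\eta$ ($\eta\in\mu_N$) that do not begin with $e_0$, and the shuffle product of words is the bilinear product with $1\mathbin{\sqcup\!\sqcup} w=w\mathbin{\sqcup\!\sqcup} 1=w$ and $we_z\mathbin{\sqcup\!\sqcup} w'e_{z'}=(we_z\mathbin{\sqcup\!\sqcup} w')e_{z'}+(w\mathbin{\sqcup\!\sqcup} w'e_{z'})e_z$. Then for all integers $r\ge 0$, $s\ge 1$, all positive integers $k_1,\dots,k_r,l_1,\dots,l_s$ and all $\eta_1,\dots,\eta_r,\xi_1,\dots,\xi_s\in\mu_N$, the series below converges (unconditionally) in $\widehat{\mathcal{A}}(N;\alpha)$ and \[L_{\widehat{\mathcal{A}},\alpha}\left(\binom{\eta_1,\dots,\eta_r}{k_1,\dots,k_r}\mathbin{\sqcup\!\sqcup} \binom{\xi_1,\dots,\xi_s}{l_1,\dots,l_s}\right)=(-1)^{l_1+\cdots+l_s}\,\xi_1^{\boldsymbol{p}}\sum_{f_1,\dots,f_s\ge 0}\left(\prod_{i=1}^s\binom{l_i+f_i-1}{f_i}\right)L_{\widehat{\mathcal{A}},\alpha}\binom{\eta_1/\xi_1,\dots,\eta_r/\xi_1,\,1/\xi_1,\,\xi_s/\xi_1,\dots,\xi_2/\xi_1}{k_1,\dots,k_r,\,l_s+f_s,\dots,l_1+f_1}\,\boldsymbol{p}^{f_1+\cdots+f_s}.\]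 -/

import Mathlib

noncomputable section

namespace FiniteMLV

/-! ### Adelic rings -/

section Adelic

variable {R : Type} [CommRing R] {ι : Type} (a : ι → R)

/-- The direct sum `⨁ᵢ R / aᵢⁿ R`, as an ideal of the product `∏ᵢ R / aᵢⁿ R`. -/
def directSumIdeal (n : ℕ+) : Ideal (∀ i, R ⧸ Ideal.span {a i} ^ (n : ℕ)) where
  carrier := {f | {i | f i ≠ 0}.Finite}
  zero_mem' := by simp
  add_mem' := by
    intro f g hf hg
    refine (Set.Finite.union hf hg).subset fun i hi => ?_
    by_contra h
    simp only [Set.mem_union, Set.mem_ofPred_eq, not_or, not_not] at h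
    exact hi (by simp [h.1, h.2])
  smul_mem' := by
    intro c f hf
    refine Set.Finite.subset hf fun i hi h => hi ?_
    simp [show f i = 0 from h]

/-- `𝒜ₙ = (∏ᵢ R / aᵢⁿ R) / (⨁ᵢ R / aᵢⁿ R)` for a family `a` of elements of `R`. -/
def AdelicLevel (n : ℕ+) : Type :=
  (∀ i, R ⧸ Ideal.span {a i} ^ (n : ℕ)) ⧸ directSumIdeal a n

instance (n : ℕ+) : CommRing (AdelicLevel a n) :=
  inferInstanceAs (CommRing (_ ⧸ directSumIdeal a n))

instance (n : ℕ+) : TopologicalSpace (AdelicLevel a n) := ⊥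

instance (n : ℕ+) : DiscreteTopology (AdelicLevel a n) := ⟨rfl⟩

/-- The class of a family in `𝒜ₙ`. -/
def levelMk (n : ℕ+) : (∀ i, R ⧸ Ideal.span {a i} ^ (n : ℕ)) →+* AdelicLevel a n :=
  Ideal.Quotient.mk (directSumIdeal a n)

/-- The natural projection `∏ᵢ R / aᵢⁿ R → ∏ᵢ R / aᵢᵐ R` for `m ≤ n`. -/
def piTransition {m n : ℕ+} (h : m ≤ n) :
    (∀ i, R ⧸ Ideal.span {a i} ^ (n : ℕ)) →+* (∀ i, R ⧸ Ideal.span {a i} ^ (m : ℕ)) :=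
  RingHom.pi fun i =>
    (Ideal.Quotient.factorPow (Ideal.span {a i}) (PNat.coe_le_coe m n |>.2 h)).comp
      (Pi.evalRingHom _ i)

/-- The natural projection `𝒜ₙ → 𝒜ₘ` for `m ≤ n`. -/
def levelTransition {m n : ℕ+} (h : m ≤ n) : AdelicLevel a n →+* AdelicLevel a m :=
  Ideal.Quotient.lift (directSumIdeal a n) ((levelMk a m).comp (piTransition a h)) (by
    intro f hf
    refine Ideal.Quotient.eq_zero_iff_mem.2 (Set.Finite.subset hf fun i hi h0 => hi ?_)
    change Ideal.Quotient.factorPow _ (PNat.coe_le_coe m n |>.2 h) (f i) = 0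
    rw [show f i = 0 from h0, map_zero])

/-- `𝒜̂ = lim 𝒜ₙ`, with the projective limit topology (subspace topology of the product of the
discrete rings `𝒜ₙ`). -/
def AdelicHat : Subring (∀ n : ℕ+, AdelicLevel a n) where
  carrier := {x | ∀ (m n : ℕ+) (h : m ≤ n), levelTransition a h (x n) = x m}
  zero_mem' := by intro m n h; simp
  one_mem' := by intro m n h; simp
  add_mem' := by intro x y hx hy m n h; simp [hx m n h, hy m n h]
  mul_mem' := by intro x y hx hy m n h; simp [hx m n h, hy m n h]
  neg_mem' := by intro x hx m n h; simp [hx m n h]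

/-- The natural projection `π : ∏ᵢ (lim R / aᵢⁿ R) → 𝒜̂`. -/
def toHat : (∀ i, AdicCompletion (Ideal.span {a i}) R) →+* AdelicHat a :=
  RingHom.codRestrict
    (RingHom.pi fun n : ℕ+ => (levelMk a n).comp <| RingHom.pi fun i =>
      ((AdicCompletion.evalₐ (Ideal.span {a i}) (n : ℕ)).toRingHom).comp (Pi.evalRingHom _ i))
    (AdelicHat a) (by
      intro x m n h
      refine congrArg (levelMk a m) (funext fun i => ?_)
      have h' : (m : ℕ) ≤ n := PNat.coe_le_coe m n |>.2 h
      obtain ⟨y, hy⟩ := AdicCompletion.mk_surjective (Ideal.span {a i}) R (x i)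
      change Ideal.Quotient.factorPow _ h' (AdicCompletion.evalₐ _ _ (x i)) =
        AdicCompletion.evalₐ _ _ (x i)
      rw [← hy, AdicCompletion.evalₐ_mk, AdicCompletion.evalₐ_mk]
      exact AdicCompletion.Ideal.mk_eq_mk (Ideal.span {a i}) h' y)

/-- `𝒜̂` is a Hausdorff space, so that the sum of a series in it is unique. -/
instance : T2Space (AdelicHat a) := inferInstance

end Adelic

/-! ### The ring `𝒜̂(N;α)` -/

/-- `ℤ[X] / (X^N - 1)`. -/
abbrev CycRing (N : ℕ) : Type := AdjoinRoot (Polynomial.X ^ N - 1 : Polynomial ℤ)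

/-- The primes congruent to `α` modulo `N`. -/
abbrev PrimesMod (N : ℕ) (α : ZMod N) : Type := {p : ℕ // p.Prime ∧ (p : ZMod N) = α}

/-- The family of the primes `p ≡ α (mod N)`, as elements of `ℤ[X] / (X^N - 1)`. -/
abbrev primeFamily (N : ℕ) (α : ZMod N) : PrimesMod N α → CycRing N := fun p => (p.1 : CycRing N)

/-- `𝒜̂(N;α)`. -/
abbrev AHat (N : ℕ) (α : ZMod N) : Type := AdelicHat (primeFamily N α)

/-- `lim R / pⁿ R` for `R = ℤ[X] / (X^N - 1)`. -/
abbrev PAdic (N : ℕ) (p : ℕ) : Type :=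
  AdicCompletion (Ideal.span {(p : CycRing N)}) (CycRing N)

/-- The natural projection onto `𝒜̂(N;α)`. -/
def proj (N : ℕ) (α : ZMod N) : (∀ p : PrimesMod N α, PAdic N p.1) →+* AHat N α :=
  toHat (primeFamily N α)

/-- The infinitely large prime `𝐩 = π((p)ₚ)`. -/
def bigPrime (N : ℕ) (α : ZMod N) : AHat N α := proj N α fun p => (p.1 : PAdic N p.1)

/-- The integers prime to `p` are invertible in `lim R / pⁿ R`. -/
theorem isUnit_natCast_padic (N p n : ℕ) (h : n.Coprime p) : IsUnit (n : PAdic N p) := by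
  have hc := AdicCompletion.isAdicComplete_self (Ideal.span {(p : CycRing N)})
    (Submodule.fg_span_singleton _)
  have hp : (p : PAdic N p) ∈ (⊥ : Ideal (PAdic N p)).jacobson := by
    refine IsAdicComplete.le_jacobson_bot ((Ideal.span {(p : CycRing N)}).map
      (algebraMap (CycRing N) (PAdic N p))) ?_
    simpa using Ideal.mem_map_of_mem (algebraMap (CycRing N) (PAdic N p))
      (Ideal.mem_span_singleton_self (p : CycRing N))
  have hb : (n : ℤ) * n.gcdA p + p * n.gcdB p = 1 := by
    rw [← Nat.gcd_eq_gcd_ab, h.gcd_eq_one, Nat.cast_one]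
  have hb' : (n : PAdic N p) * (n.gcdA p : ℤ) = (p : PAdic N p) * (-(n.gcdB p : ℤ) : ℤ) + 1 := by
    have := congrArg (Int.cast : ℤ → PAdic N p) hb
    push_cast at this ⊢
    linear_combination this
  exact isUnit_of_mul_isUnit_left (hb' ▸ Ideal.mem_jacobson_bot.1 hp _)

/-- Every nonzero integer is invertible in `𝒜̂(N;α)`. -/
theorem isUnit_intCast_hat (N : ℕ) (α : ZMod N) (d : ℤ) (hd : d ≠ 0) :
    IsUnit (d : AHat N α) := by
  have key : ∀ n : ℕ+, ∃ y : AdelicLevel (primeFamily N α) n, (d : AdelicLevel _ n) * y = 1 := by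
    intro n
    refine ⟨levelMk _ n fun p => Ring.inverse (d : CycRing N ⧸ _), ?_⟩
    rw [← map_intCast (levelMk (primeFamily N α) n), ← map_mul, ← map_one (levelMk _ n)]
    refine Ideal.Quotient.eq.2 (Set.Finite.subset (s := {p | p.1 ∣ d.natAbs}) ?_ fun p hp => ?_)
    · exact Set.Finite.of_injOn (f := Subtype.val) (t := (d.natAbs.divisors : Set ℕ))
        (fun p hp => by simpa [hd] using hp) Subtype.val_injective.injOn (Finset.finite_toSet _)
    · by_contra hpd
      refine hp (sub_eq_zero.2 (Ring.mul_inverse_cancel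
        ((d : ∀ q : PrimesMod N α, CycRing N ⧸ Ideal.span {primeFamily N α q} ^ (n : ℕ)) p) ?_))
      have hu : IsUnit ((d.natAbs : ℕ) : CycRing N ⧸ Ideal.span {primeFamily N α p} ^ (n : ℕ)) := by
        have := (isUnit_natCast_padic N p.1 d.natAbs
          ((Nat.Prime.coprime_iff_not_dvd p.2.1).2 hpd).symm).map
            (AdicCompletion.evalₐ (Ideal.span {(p.1 : CycRing N)}) (n : ℕ))
        simpa using this
      rcases Int.natAbs_eq d with h | h
      · rw [Pi.intCast_apply, h, Int.cast_natCast]; exact hu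
      · rw [Pi.intCast_apply, h, Int.cast_neg, Int.cast_natCast]; exact hu.neg
  choose y hy using key
  refine IsUnit.of_mul_eq_one ⟨y, fun m n h => ?_⟩ (Subtype.ext (funext hy))
  have h1 := congrArg (levelTransition (primeFamily N α) h) (hy n)
  rw [map_mul, map_intCast, map_one] at h1
  calc levelTransition _ h (y n) = (d * y m) * levelTransition _ h (y n) := by rw [hy m, one_mul]
    _ = y m * (d * levelTransition _ h (y n)) := by ring
    _ = y m := by rw [h1, mul_one]

/-- The canonical `ℚ`-algebra structure of `𝒜̂(N;α)`. -/
instance (N : ℕ) (α : ZMod N) : Algebra ℚ (AHat N α) :=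
  (IsLocalization.lift (M := nonZeroDivisors ℤ) (S := ℚ) (g := Int.castRingHom (AHat N α))
    fun d => isUnit_intCast_hat N α d (nonZeroDivisors.ne_zero d.2)).toAlgebra

/-! ### Roots of unity -/

/-- The class of `X`, as a unit of `ℤ[X] / (X^N - 1)`. -/
def xUnit (N : ℕ) [NeZero N] : (CycRing N)ˣ :=
  Units.ofPowEqOne (AdjoinRoot.root (Polynomial.X ^ N - 1 : Polynomial ℤ)) N
    (by
      have h := AdjoinRoot.eval₂_root (Polynomial.X ^ N - 1 : Polynomial ℤ)
      simpa [sub_eq_zero] using h)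
    (NeZero.ne N)

/-- The identification of the group `μ_N` of complex `N`-th roots of unity with the group of the
classes of the powers of `X` in `ℤ[X] / (X^N - 1)` that sends the primitive root `ζ` to `X`. -/
def muHom (N : ℕ) [NeZero N] (ζ : rootsOfUnity N ℂ) (hζ : IsPrimitiveRoot ζ N) :
    rootsOfUnity N ℂ →* (CycRing N)ˣ :=
  monoidHomOfForallMemZpowers (g := ζ) (g' := xUnit N)
    (by
      intro x
      have h : (x : ℂˣ) ∈ Subgroup.zpowers (ζ : ℂˣ) := by
        rw [IsPrimitiveRoot.zpowers_eq (IsPrimitiveRoot.coe_submonoidClass_iff.2 hζ)]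
        exact x.2
      obtain ⟨i, hi⟩ := h
      exact ⟨i, Subtype.ext (by simpa using hi)⟩)
    (by
      rw [← hζ.eq_orderOf]
      exact orderOf_dvd_of_pow_eq_one (Units.pow_ofPowEqOne _ _))

/-! ### Words, indices and the shuffle product -/

section Shuffle

variable {D : Type}

/-- The basis of `ℚ⟨e_z ∣ z ∈ D⟩` formed by the words. -/
abbrev wordBasis (D : Type) : Module.Basis (FreeMonoid D) ℚ (FreeAlgebra ℚ D) :=
  FreeAlgebra.basisFreeMonoid ℚ D

/-- The shuffle product of two words, each given by the list of its letters from the last one to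
the first one:
`1 ш w = w ш 1 = w` and `w e_z ш w' e_z' = (w e_z ш w') e_z' + (w ш w' e_z') e_z`. -/
def shuffleRev : List D → List D → FreeAlgebra ℚ D
  | [], v => (v.reverse.map (FreeAlgebra.ι ℚ)).prod
  | z :: u, [] => ((z :: u).reverse.map (FreeAlgebra.ι ℚ)).prod
  | z :: u, z' :: v =>
      shuffleRev (z :: u) v * FreeAlgebra.ι ℚ z' + shuffleRev u (z' :: v) * FreeAlgebra.ι ℚ z
  termination_by u v => u.length + v.length

/-- The shuffle product on `ℚ⟨e_z ∣ z ∈ D⟩`. -/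
def shuffle : FreeAlgebra ℚ D →ₗ[ℚ] FreeAlgebra ℚ D →ₗ[ℚ] FreeAlgebra ℚ D :=
  (wordBasis D).constr ℚ fun u => (wordBasis D).constr ℚ fun v =>
    shuffleRev (FreeMonoid.toList u).reverse (FreeMonoid.toList v).reverse

variable (μ : Type)

/-- Tuples `(a₁, …, a_r; k₁, …, k_r)` with `aᵢ ∈ μ` and `kᵢ` positive integers, `r ≥ 0`. -/
abbrev Index : Type := List (μ × ℕ+)

/-- The `ℚ`-vector space with basis the tuples `(a₁, …, a_r; k₁, …, k_r)`. -/
abbrev IndexSpace : Type := Index μ →₀ ℚ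

variable {μ}

/-- The word `∏ᵢ e_{aᵢ} e_0^{kᵢ - 1}`, with the letters `e_0` and `e_a`, `a ∈ μ`. -/
def indexWord (t : Index μ) : FreeAlgebra ℚ (WithZero μ) :=
  (t.map fun c => FreeAlgebra.ι ℚ (c.1 : WithZero μ) *
    FreeAlgebra.ι ℚ (0 : WithZero μ) ^ ((c.2 : ℕ) - 1)).prod

/-- `W`, the `ℚ`-linear extension of `indexWord`. -/
def toWords : IndexSpace μ →ₗ[ℚ] FreeAlgebra ℚ (WithZero μ) :=
  Finsupp.linearCombination ℚ indexWord

/-- Decomposition of a list of letters as `m` letters `0`, followed by the letters of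
`∏ᵢ e_{aᵢ} e_0^{kᵢ - 1}`. -/
def parse : List (WithZero μ) → ℕ × Index μ
  | [] => (0, [])
  | none :: w => ((parse w).1 + 1, (parse w).2)
  | some c :: w => (0, (c, (parse w).1.succPNat) :: (parse w).2)

/-- `W⁻¹`, extended by `0` to the words that begin with `e_0`. -/
def ofWords : FreeAlgebra ℚ (WithZero μ) →ₗ[ℚ] IndexSpace μ :=
  (wordBasis (WithZero μ)).constr ℚ fun w =>
    if (parse (FreeMonoid.toList w)).1 = 0
    then Finsupp.single (parse (FreeMonoid.toList w)).2 1 else 0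

/-- The shuffle product `a ш b = W⁻¹(W(a) ш W(b))` of tuples. -/
def indexShuffle (x y : IndexSpace μ) : IndexSpace μ :=
  ofWords (shuffle (toWords x) (toWords y))

/-! The defining rules of the shuffle product, and `W⁻¹ ∘ W = id`. -/

theorem wordBasis_apply (w : List D) :
    wordBasis D (FreeMonoid.ofList w) = (w.map (FreeAlgebra.ι ℚ)).prod := by
  simp [wordBasis, FreeAlgebra.basisFreeMonoid, FreeAlgebra.equivMonoidAlgebraFreeMonoid,
    FreeMonoid.lift_apply]

theorem shuffle_words (u v : List D) :
    shuffle (u.map (FreeAlgebra.ι ℚ)).prod (v.map (FreeAlgebra.ι ℚ)).prod =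
      shuffleRev u.reverse v.reverse := by
  rw [← wordBasis_apply, ← wordBasis_apply, shuffle, Module.Basis.constr_basis,
    Module.Basis.constr_basis]
  rfl

/-- `1 ш w = w`. -/
theorem one_shuffle (w : FreeAlgebra ℚ D) : shuffle 1 w = w := by
  suffices h : shuffle (1 : FreeAlgebra ℚ D) = LinearMap.id from by rw [h]; rfl
  refine (wordBasis D).ext fun v => ?_
  have h := shuffle_words ([] : List D) (FreeMonoid.toList v)
  rw [← wordBasis_apply v.toList] at h
  simpa [shuffleRev, ← wordBasis_apply] using h

theorem word_induction {P : FreeAlgebra ℚ D → Prop} (w : FreeAlgebra ℚ D)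
    (hw : ∀ u : List D, P (u.map (FreeAlgebra.ι ℚ)).prod) (h0 : P 0)
    (ha : ∀ a b, P a → P b → P (a + b)) (hs : ∀ (c : ℚ) a, P a → P (c • a)) : P w := by
  have hm : w ∈ Submodule.span ℚ (Set.range (wordBasis D)) := by
    rw [(wordBasis D).span_eq]; trivial
  induction hm using Submodule.span_induction with
  | mem x hx =>
    obtain ⟨u, rfl⟩ := hx
    have := hw u.toList
    rwa [← wordBasis_apply] at this
  | zero => exact h0
  | add a b _ _ h1 h2 => exact ha a b h1 h2
  | smul c a _ h1 => exact hs c a h1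

/-- `w ш 1 = w`. -/
theorem shuffle_one (w : FreeAlgebra ℚ D) : shuffle w 1 = w := by
  have h2 : ∀ u : List D, shuffleRev u [] = (u.reverse.map (FreeAlgebra.ι ℚ)).prod := by
    rintro (_ | ⟨a, u⟩) <;> simp [shuffleRev]
  refine word_induction (P := fun w => shuffle w 1 = w) w (fun u => ?_) (by simp)
    (fun a b ha hb => by simp [ha, hb])
    (fun c a ha => by simp [ha])
  have h := shuffle_words u ([] : List D)
  simpa [h2] using h

/-- `w e_z ш w' e_z' = (w e_z ш w') e_z' + (w ш w' e_z') e_z`. -/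
theorem shuffle_mul_letter (w w' : FreeAlgebra ℚ D) (z z' : D) :
    shuffle (w * FreeAlgebra.ι ℚ z) (w' * FreeAlgebra.ι ℚ z') =
      shuffle (w * FreeAlgebra.ι ℚ z) w' * FreeAlgebra.ι ℚ z' +
        shuffle w (w' * FreeAlgebra.ι ℚ z') * FreeAlgebra.ι ℚ z := by
  refine word_induction (P := fun w => shuffle (w * FreeAlgebra.ι ℚ z) (w' * FreeAlgebra.ι ℚ z') =
      shuffle (w * FreeAlgebra.ι ℚ z) w' * FreeAlgebra.ι ℚ z' +
        shuffle w (w' * FreeAlgebra.ι ℚ z') * FreeAlgebra.ι ℚ z) w (fun u => ?_) (by simp)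
    (fun a b ha hb => by simp only [add_mul, map_add, LinearMap.add_apply, ha, hb]; abel)
    (fun c a ha => by simp only [smul_mul_assoc, map_smul, LinearMap.smul_apply, ha, smul_add])
  obtain ⟨x, hx⟩ : ∃ x, x = (u.map (FreeAlgebra.ι ℚ)).prod := ⟨_, rfl⟩
  rw [← hx]
  refine word_induction (P := fun w' => shuffle (x * FreeAlgebra.ι ℚ z) (w' * FreeAlgebra.ι ℚ z') =
      shuffle (x * FreeAlgebra.ι ℚ z) w' * FreeAlgebra.ι ℚ z' +
        shuffle x (w' * FreeAlgebra.ι ℚ z') * FreeAlgebra.ι ℚ z) w' (fun v => ?_) (by simp)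
    (fun a b ha hb => by simp only [add_mul, map_add, ha, hb]; abel)
    (fun c a ha => by simp only [smul_mul_assoc, map_smul, ha, smul_add])
  subst hx
  have e : ∀ (u : List D) (z : D), (u.map (FreeAlgebra.ι ℚ)).prod * FreeAlgebra.ι ℚ z =
      ((u ++ [z]).map (FreeAlgebra.ι ℚ)).prod := by simp
  rw [e, e, shuffle_words, shuffle_words, shuffle_words]
  simp only [List.reverse_append, List.reverse_cons, List.reverse_nil, List.nil_append,
    List.singleton_append]
  rw [shuffleRev]

/-- The letters of `indexWord`. -/
def indexLetters (t : Index μ) : List (WithZero μ) :=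
  t.flatMap fun c => (c.1 : WithZero μ) :: List.replicate ((c.2 : ℕ) - 1) 0

theorem indexWord_eq (t : Index μ) :
    indexWord t = ((indexLetters t).map (FreeAlgebra.ι ℚ)).prod := by
  induction t with
  | nil => simp [indexWord, indexLetters]
  | cons c t ih =>
    simp only [indexWord, indexLetters, List.map_cons, List.prod_cons, List.flatMap_cons,
      List.map_append, List.prod_append, List.map_replicate, List.prod_replicate] at ih ⊢
    rw [ih]

theorem parse_replicate (n : ℕ) (w : List (WithZero μ)) :
    parse (List.replicate n 0 ++ w) = ((parse w).1 + n, (parse w).2) := by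
  induction n with
  | zero => rfl
  | succ n ih =>
    rw [List.replicate_succ, List.cons_append]
    change ((parse _).1 + 1, (parse _).2) = _
    rw [ih]; rfl

theorem parse_indexLetters (t : Index μ) : parse (indexLetters t) = (0, t) := by
  induction t with
  | nil => rfl
  | cons c t ih =>
    rw [indexLetters, List.flatMap_cons, List.cons_append]
    change (0, (c.1, (parse _).1.succPNat) :: (parse _).2) = _
    rw [parse_replicate]
    change (0, (c.1, ((parse (indexLetters t)).1 + _).succPNat) :: (parse (indexLetters t)).2) = _
    rw [ih]
    have : (0 + ((c.2 : ℕ) - 1)).succPNat = c.2 := by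
      apply PNat.coe_injective; have := c.2.pos; simp only [Nat.succPNat_coe]; omega
    rw [this]

theorem indexLetters_parse (w : List (WithZero μ)) :
    List.replicate (parse w).1 0 ++ indexLetters (parse w).2 = w := by
  induction w with
  | nil => rfl
  | cons c w ih =>
    cases c with
    | zero =>
      change List.replicate ((parse w).1 + 1) 0 ++ indexLetters (parse w).2 = _
      rw [List.replicate_succ, List.cons_append, ih]
    | coe c =>
      change indexLetters ((c, (parse w).1.succPNat) :: (parse w).2) = _
      rw [indexLetters, List.flatMap_cons, List.cons_append]
      change _ :: (List.replicate (parse w).1 0 ++ indexLetters (parse w).2) = _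
      rw [ih]

/-- `ofWords` is a left inverse of `W`. -/
theorem ofWords_toWords (x : IndexSpace μ) : ofWords (toWords x) = x := by
  suffices h : ofWords ∘ₗ toWords = (LinearMap.id : IndexSpace μ →ₗ[ℚ] _) from
    LinearMap.congr_fun h x
  ext1 t
  ext1
  simp only [LinearMap.comp_apply, Finsupp.lsingle_apply, LinearMap.id_apply, toWords,
    Finsupp.linearCombination_single, one_smul]
  rw [indexWord_eq, ← wordBasis_apply, ofWords, Module.Basis.constr_basis, FreeMonoid.toList_ofList,
    parse_indexLetters]
  simp

theorem toWords_ofWords_word (w : List (WithZero μ)) (hw : w.head? ≠ some 0) :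
    toWords (ofWords (w.map (FreeAlgebra.ι ℚ)).prod) = (w.map (FreeAlgebra.ι ℚ)).prod := by
  have h := indexLetters_parse w
  have h0 : (parse w).1 = 0 := by
    by_contra hne
    obtain ⟨n, hn⟩ := Nat.exists_eq_succ_of_ne_zero hne
    rw [hn, List.replicate_succ, List.cons_append] at h
    rw [← h] at hw; simp at hw
  rw [← wordBasis_apply, ofWords, Module.Basis.constr_basis, FreeMonoid.toList_ofList, if_pos h0,
    toWords, Finsupp.linearCombination_single, one_smul, indexWord_eq, wordBasis_apply]
  rw [h0] at h
  simpa using congrArg (fun w => (List.map (FreeAlgebra.ι ℚ) w).prod) h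

theorem shuffleRev_mem (u v : List (WithZero μ)) (hu : u.getLast? ≠ some 0)
    (hv : v.getLast? ≠ some 0) :
    shuffleRev u v ∈ Submodule.span ℚ {x | ∃ w : List (WithZero μ), w.head? ≠ some 0 ∧
      (w = [] → u = [] ∧ v = []) ∧ x = (w.map (FreeAlgebra.ι ℚ)).prod} := by
  have step : ∀ (P : Prop) (y : FreeAlgebra ℚ (WithZero μ)) (z : WithZero μ), ¬ P →
      y ∈ Submodule.span ℚ {x | ∃ w : List (WithZero μ), w.head? ≠ some 0 ∧
      (w = [] → P) ∧ x = (w.map (FreeAlgebra.ι ℚ)).prod} → ∀ Q : Prop,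
      y * FreeAlgebra.ι ℚ z ∈ Submodule.span ℚ {x | ∃ w : List (WithZero μ), w.head? ≠ some 0 ∧
      (w = [] → Q) ∧ x = (w.map (FreeAlgebra.ι ℚ)).prod} := by
    intro P y z hP hy Q
    induction hy using Submodule.span_induction with
    | mem x hx =>
      obtain ⟨w, h1, h2, rfl⟩ := hx
      have hw : w ≠ [] := fun h => hP (h2 h)
      refine Submodule.subset_span ⟨w ++ [z], ?_, by simp, by simp⟩
      rwa [List.head?_append_of_ne_nil _ hw]
    | zero => simp
    | add a b _ _ h1 h2 => rw [add_mul]; exact Submodule.add_mem _ h1 h2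
    | smul c a _ h1 => rw [smul_mul_assoc]; exact Submodule.smul_mem _ _ h1
  induction u, v using shuffleRev.induct with
  | case1 v =>
    refine Submodule.subset_span ⟨v.reverse, by simpa using hv, by simp, by simp [shuffleRev]⟩
  | case2 z u =>
    refine Submodule.subset_span ⟨(z :: u).reverse, by rwa [List.head?_reverse],
      by simp, by simp [shuffleRev]⟩
  | case3 z u z' v ih1 ih2 =>
    have tl : ∀ (z : WithZero μ) u, (z :: u).getLast? ≠ some 0 → u.getLast? ≠ some 0 := by
      intro z u h; cases u with
      | nil => simp
      | cons b u => simpa using h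
    rw [shuffleRev]
    exact Submodule.add_mem _ (step _ _ _ (by simp) (ih1 hu (tl _ _ hv)) _)
      (step _ _ _ (by simp) (ih2 (tl _ _ hu) hv) _)

/-- `W(a ш b) = W(a) ш W(b)`: the words that begin with `e_0` play no role in `indexShuffle`. -/
theorem toWords_indexShuffle (x y : IndexSpace μ) :
    toWords (indexShuffle x y) = shuffle (toWords x) (toWords y) := by
  have hh : ∀ t : Index μ, (indexLetters t).head? ≠ some 0 := by
    rintro (_ | ⟨c, t⟩) <;> simp [indexLetters]
  have main : ∀ t t' : Index μ, toWords (ofWords (shuffle (indexWord t) (indexWord t'))) =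
      shuffle (indexWord t) (indexWord t') := by
    intro t t'
    rw [indexWord_eq, indexWord_eq, shuffle_words]
    have h := shuffleRev_mem (indexLetters t).reverse (indexLetters t').reverse
      (by simpa using hh t) (by simpa using hh t')
    generalize shuffleRev (indexLetters t).reverse (indexLetters t').reverse = q at h ⊢
    induction h using Submodule.span_induction with
    | mem x hx =>
      obtain ⟨w, h1, -, rfl⟩ := hx
      exact toWords_ofWords_word w h1
    | zero => simp
    | add a b _ _ h1 h2 => rw [map_add, map_add, h1, h2]
    | smul c a _ h1 => rw [map_smul, map_smul, h1]
  unfold indexShuffle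
  induction x using Finsupp.induction_linear with
  | zero => simp
  | add a b ha hb => simp only [map_add, LinearMap.add_apply, ha, hb]
  | single t c =>
    induction y using Finsupp.induction_linear with
    | zero => simp
    | add a b ha hb => simp only [map_add, ha, hb]
    | single t' c' =>
      have e : ∀ (t : Index μ) (c : ℚ), toWords (Finsupp.single t c) = c • indexWord t := by
        intro t c; simp [toWords]
      simp only [e, map_smul, LinearMap.smul_apply, main]

end Shuffle

/-! ### Finite multiple `L`-values -/

/-- `∑_{0 < n₁ < ⋯ < n_r < M} η₁^{n₁} η₂^{n₂ - n₁} ⋯ η_r^{n_r - n_{r-1}} / (n₁^{k₁} ⋯ n_r^{k_r})`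
in a commutative ring in which `1, …, M - 1` are invertible; `χ` says how the `ηᵢ` are read in that
ring. In the term of index `i`, `Fin.cons 0 n i.castSucc` is `n_{i-1}`, with `n₀ = 0`. -/
def truncL {A μ : Type} [CommRing A] [Monoid μ] (χ : μ →* A) (M : ℕ) (t : Index μ) : A :=
  ∑ n ∈ (Fintype.piFinset fun _ : Fin t.length => Finset.Ioo 0 M) with StrictMono n,
    ∏ i : Fin t.length,
      χ (t.get i).1 ^ (n i - (Fin.cons 0 n : Fin (t.length + 1) → ℕ) i.castSucc) *
        Ring.inverse (n i : A) ^ ((t.get i).2 : ℕ)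

section LValues

variable (N : ℕ) [NeZero N] (α : ZMod N) (ζ : rootsOfUnity N ℂ) (hζ : IsPrimitiveRoot ζ N)

/-- A root of unity as an element of `lim R / pⁿ R`. -/
def muPAdic (p : ℕ) : rootsOfUnity N ℂ →* PAdic N p :=
  (algebraMap (CycRing N) (PAdic N p)).toMonoidHom.comp
    ((Units.coeHom (CycRing N)).comp (muHom N ζ hζ))

/-- The `𝐩`-adic finite multiple `L`-value of a tuple. -/
def LHat (t : Index (rootsOfUnity N ℂ)) : AHat N α :=
  proj N α fun p => truncL (muPAdic N ζ hζ p.1) p.1 t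

/-- The `ℚ`-linear extension of the `𝐩`-adic finite multiple `L`-values. -/
def LHatLin : IndexSpace (rootsOfUnity N ℂ) →ₗ[ℚ] AHat N α :=
  Finsupp.linearCombination ℚ (LHat N α ζ hζ)

/-- `η^𝐩 = π((η^p)ₚ)`. -/
def powBigPrime (η : rootsOfUnity N ℂ) : AHat N α :=
  proj N α fun p => muPAdic N ζ hζ p.1 η ^ p.1

end LValues

/-- The tuple
`(η₁/ξ₁, …, η_r/ξ₁, 1/ξ₁, ξ_s/ξ₁, …, ξ₂/ξ₁; k₁, …, k_r, l_s + f_s, …, l₁ + f₁)`. The column that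
contains `l_j + f_j` has the color `ξ_{j+1}/ξ₁`, where `ξ_{s+1} = 1`. -/
def reflectedIndex {μ : Type} [Group μ] {r s : ℕ} (η : Fin r → μ) (k : Fin r → ℕ+)
    (ξ : Fin (s + 1) → μ) (l : Fin (s + 1) → ℕ+) (f : Fin (s + 1) → ℕ) : Index μ :=
  (List.ofFn fun i => (η i / ξ 0, k i)) ++
    List.reverse (List.ofFn fun j : Fin (s + 1) =>
      (((Fin.snoc (fun i : Fin s => ξ i.succ) 1 : Fin (s + 1) → μ) j / ξ 0,
        ⟨l j + f j, Nat.add_pos_left (l j).pos _⟩) : μ × ℕ+))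

end FiniteMLV

end

/-!
Modulo `x^p`, the series `∑ₙ cₙ xⁿ` whose coefficients are the partial nested sums are iterated
integrals of the forms `dx / x` and `y dx / (1 - y x)`, because `1, …, p - 1` are invertible.
Integration by parts therefore turns the shuffle product of two words into the product of their
series, and the left-hand side becomes a convolution `∑_{a + b = p} cₐ d_b` of two nested sums.

Replacing `b` by `p - b`, and likewise every summation index of the second sum, reverses the second
chain and puts it behind the first one, so that a single nested sum remains, with weights
`1 / (p - n)^l` instead of `1 / n^l` on the second part. At each finite level `p` is nilpotent, and
`1 / (p - n)^l = (-1)^l ∑_f binom(l + f - 1, f) p^f / n^(l + f)` is a finite sum. The colors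
`ξ₂, …, ξ_s, 1` now follow a chain that ends at `p` with the color `ξ₁`; dividing all colors by `ξ₁`
produces the factor `ξ₁^p`.

Writing the steps of a chain as strictly upper triangular matrices and the weights as diagonal
matrices makes the reversal the reflection in the antidiagonal, which is an antiautomorphism, and
the division of the colors a conjugation by a diagonal matrix.
-/

noncomputable section

namespace FiniteMLV

open Finset Matrix PowerSeries

/-! ### Shuffles of words -/

section Shuffle

variable {D : Type*} {μ : Type}

/-- The shuffles of two words, counted with multiplicity, all words being given as lists of letters
from the last one to the first one, as in `shuffleRev`. -/
def shuffleList : List D → List D → List (List D)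
  | [], v => [v]
  | z :: u, [] => [z :: u]
  | z :: u, z' :: v =>
      (shuffleList (z :: u) v).map (z' :: ·) ++ (shuffleList u (z' :: v)).map (z :: ·)
  termination_by u v => u.length + v.length

theorem shuffleRev_eq_sum_shuffleList {D : Type} (u v : List D) :
    shuffleRev u v =
      ((shuffleList u v).map fun w => (w.reverse.map (FreeAlgebra.ι ℚ)).prod).sum := by
  induction u, v using shuffleList.induct with
  | case1 v => simp [shuffleRev, shuffleList]
  | case2 z u => simp [shuffleRev, shuffleList]
  | case3 z u z' v ih₁ ih₂ =>
    rw [shuffleRev, shuffleList, ih₁, ih₂, List.map_append, List.sum_append, List.map_map,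
      List.map_map, ← List.sum_map_mul_right, ← List.sum_map_mul_right]
    simp [Function.comp_def]

theorem getLast?_eq_or_eq_of_mem_shuffleList {u v w : List D} (hw : w ∈ shuffleList u v) :
    w.getLast? = u.getLast? ∨ w.getLast? = v.getLast? := by
  induction u, v using shuffleList.induct generalizing w with
  | case1 v => simp_all [shuffleList]
  | case2 z u => simp_all [shuffleList]
  | case3 z u z' v ih₁ ih₂ =>
    simp only [shuffleList, List.mem_append, List.mem_map] at hw
    rcases hw with ⟨w, hw, rfl⟩ | ⟨w, hw, rfl⟩
    · rcases ih₁ hw with h | h <;> simp [List.getLast?_cons, h]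
    · rcases ih₂ hw with h | h <;> simp [List.getLast?_cons, h]

theorem getLast?_ne_of_mem_shuffleList {z : D} {u v w : List D} (hu : u.getLast? ≠ some z)
    (hv : v.getLast? ≠ some z) (hw : w ∈ shuffleList u v) : w.getLast? ≠ some z := by
  rcases getLast?_eq_or_eq_of_mem_shuffleList hw with h | h <;> rwa [h]

theorem getLast?_ne_of_getLast?_cons_ne {z c : D} {u : List D} (h : (c :: u).getLast? ≠ some z) :
    u.getLast? ≠ some z := by
  intro hu
  simp [List.getLast?_cons, hu] at h

theorem parse_fst_eq_zero {w : List (WithZero μ)} (hw : w.head? ≠ some 0) : (parse w).1 = 0 :=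
  match w, hw with
  | [], _ => rfl
  | none :: _, hw => absurd rfl hw
  | some _ :: _, _ => rfl

theorem getLast?_reverse_indexLetters (t : Index μ) :
    (indexLetters t).reverse.getLast? ≠ some 0 := by
  rcases t with _ | ⟨c, t⟩ <;> simp [indexLetters]

theorem parse_fst_of_mem_shuffleList {t t' : Index μ} {w : List (WithZero μ)}
    (hw : w ∈ shuffleList (indexLetters t).reverse (indexLetters t').reverse) :
    (parse w.reverse).1 = 0 := by
  refine parse_fst_eq_zero ?_
  rw [List.head?_reverse]
  exact getLast?_ne_of_mem_shuffleList (getLast?_reverse_indexLetters t)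
    (getLast?_reverse_indexLetters t') hw

theorem indexShuffle_single_single (t t' : Index μ) :
    indexShuffle (Finsupp.single t 1) (Finsupp.single t' 1) =
      ((shuffleList (indexLetters t).reverse (indexLetters t').reverse).map fun w =>
        Finsupp.single (parse w.reverse).2 1).sum := by
  have toWords_single (t : Index μ) : toWords (Finsupp.single t 1) =
      ((indexLetters t).map (FreeAlgebra.ι ℚ)).prod := by
    simp [toWords, indexWord_eq]
  rw [indexShuffle, toWords_single, toWords_single, shuffle_words, shuffleRev_eq_sum_shuffleList,
    map_list_sum, List.map_map]
  refine congrArg List.sum (List.map_congr_left fun w hw => ?_)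
  rw [Function.comp_apply, ← wordBasis_apply, ofWords, Module.Basis.constr_basis,
    FreeMonoid.toList_ofList, if_pos (parse_fst_of_mem_shuffleList hw)]

end Shuffle

/-! ### Words as iterated integrals -/

section WordSeries

variable {A μ : Type*} [CommRing A] {M : ℕ}

theorem smodEq_span_X_pow_iff {F G : A⟦X⟧} :
    F ≡ G [SMOD Ideal.span {(X : A⟦X⟧) ^ M}] ↔ ∀ n < M, coeff n F = coeff n G := by
  simp only [SModEq.sub_mem, Ideal.mem_span_singleton, X_pow_dvd_iff, map_sub, sub_eq_zero]

theorem coeff_X_mul_derivative (F : A⟦X⟧) (n : ℕ) :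
    coeff n (X * derivative A F) = n * coeff n F := by
  cases n with
  | zero => simp
  | succ n => rw [coeff_succ_X_mul, coeff_derivative, Nat.cast_succ, mul_comm]

theorem smodEq_of_X_mul_derivative_smodEq (hM : ∀ n, 0 < n → n < M → IsUnit (n : A)) {F G : A⟦X⟧}
    (h₀ : constantCoeff F = constantCoeff G)
    (h : X * derivative A F ≡ X * derivative A G [SMOD Ideal.span {(X : A⟦X⟧) ^ M}]) :
    F ≡ G [SMOD Ideal.span {(X : A⟦X⟧) ^ M}] := by
  rw [smodEq_span_X_pow_iff] at h ⊢
  intro n hn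
  rcases n.eq_zero_or_pos with rfl | hpos
  · simpa only [coeff_zero_eq_constantCoeff_apply] using h₀
  · exact (hM n hpos hn).mul_left_cancel (by simpa only [coeff_X_mul_derivative] using h n hn)

variable [Monoid μ] (χ : μ →* A)

/-- The power series `x · ω_z`, where `ω_0 = dx / x` and `ω_y = y dx / (1 - y x)` are the
differential forms attached to the letters. -/
def letterSeries : WithZero μ → A⟦X⟧
  | none => 1
  | some y => mk fun n => if n = 0 then 0 else χ y ^ n

/-- The iterated integral attached to a word, as a formal power series; the word is given as the
list of its letters from the last one to the first one. The last letter is the outermost form, and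
`∫ F dx / x` is computed by dividing the `n`-th coefficient of `F` by `n`, with the value `0` if `n`
is not invertible. -/
def wordSeries : List (WithZero μ) → A⟦X⟧
  | [] => 1
  | z :: u => mk fun n => Ring.inverse (n : A) * coeff n (wordSeries u * letterSeries χ z)

theorem letterSeries_zero : letterSeries χ 0 = 1 :=
  rfl

theorem coeff_letterSeries_coe (y : μ) (n : ℕ) :
    coeff n (letterSeries χ (y : WithZero μ)) = if n = 0 then 0 else χ y ^ n := by
  rw [← coeff_mk n fun n => if n = 0 then 0 else χ y ^ n]
  rfl

theorem coeff_wordSeries_cons (z : WithZero μ) (u : List (WithZero μ)) (n : ℕ) :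
    coeff n (wordSeries χ (z :: u)) =
      Ring.inverse (n : A) * coeff n (wordSeries χ u * letterSeries χ z) := by
  rw [wordSeries, coeff_mk]

theorem constantCoeff_wordSeries_cons (z : WithZero μ) (u : List (WithZero μ)) :
    constantCoeff (wordSeries χ (z :: u)) = 0 := by
  rw [← coeff_zero_eq_constantCoeff_apply, coeff_wordSeries_cons, Nat.cast_zero,
    Ring.inverse_zero, zero_mul]

theorem constantCoeff_wordSeries_mul_letterSeries {z : WithZero μ} {u : List (WithZero μ)}
    (h : (z :: u).getLast? ≠ some 0) :
    constantCoeff (wordSeries χ u * letterSeries χ z) = 0 := by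
  rw [map_mul]
  cases z with
  | coe y => rw [← coeff_zero_eq_constantCoeff_apply (letterSeries χ _), coeff_letterSeries_coe,
      if_pos rfl, mul_zero]
  | zero =>
    cases u with
    | nil => simp at h
    | cons c u => rw [constantCoeff_wordSeries_cons, zero_mul]

theorem X_mul_derivative_wordSeries_cons (hM : ∀ n, 0 < n → n < M → IsUnit (n : A))
    {z : WithZero μ} {u : List (WithZero μ)} (h : (z :: u).getLast? ≠ some 0) :
    X * derivative A (wordSeries χ (z :: u)) ≡ wordSeries χ u * letterSeries χ z
      [SMOD Ideal.span {(X : A⟦X⟧) ^ M}] := by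
  rw [smodEq_span_X_pow_iff]
  intro n hn
  rw [coeff_X_mul_derivative, coeff_wordSeries_cons]
  rcases n.eq_zero_or_pos with rfl | hpos
  · rw [Nat.cast_zero, zero_mul, coeff_zero_eq_constantCoeff_apply,
      constantCoeff_wordSeries_mul_letterSeries χ h]
  · rw [Ring.mul_inverse_cancel_left _ _ (hM n hpos hn)]

theorem X_mul_derivative_sum_wordSeries_cons (hM : ∀ n, 0 < n → n < M → IsUnit (n : A))
    {z : WithZero μ} {L : List (List (WithZero μ))}
    (h : ∀ w ∈ L, (z :: w).getLast? ≠ some 0) :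
    X * derivative A ((L.map fun w => wordSeries χ (z :: w)).sum) ≡
      (L.map (wordSeries χ)).sum * letterSeries χ z [SMOD Ideal.span {(X : A⟦X⟧) ^ M}] := by
  induction L with
  | nil => simp [SModEq.refl]
  | cons w L ih =>
    simp only [List.forall_mem_cons] at h
    simp only [List.map_cons, List.sum_cons, map_add, mul_add, add_mul]
    exact (X_mul_derivative_wordSeries_cons χ hM h.1).add (ih h.2)

theorem constantCoeff_sum_wordSeries_cons (z : WithZero μ) (L : List (List (WithZero μ))) :
    constantCoeff (L.map fun w => wordSeries χ (z :: w)).sum = 0 := by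
  rw [map_list_sum, List.map_map]
  exact List.sum_eq_zero (by simp [constantCoeff_wordSeries_cons])

theorem X_mul_derivative_wordSeries_cons_mul (hM : ∀ n, 0 < n → n < M → IsUnit (n : A))
    {z z' : WithZero μ} {u v : List (WithZero μ)} (hu : (z :: u).getLast? ≠ some 0)
    (hv : (z' :: v).getLast? ≠ some 0) :
    X * derivative A (wordSeries χ (z :: u) * wordSeries χ (z' :: v)) ≡
      wordSeries χ (z :: u) * wordSeries χ v * letterSeries χ z' +
        wordSeries χ u * wordSeries χ (z' :: v) * letterSeries χ z
      [SMOD Ideal.span {(X : A⟦X⟧) ^ M}] := by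
  have hF := X_mul_derivative_wordSeries_cons χ hM hu
  have hG := X_mul_derivative_wordSeries_cons χ hM hv
  rw [Derivation.leibniz, smul_eq_mul, smul_eq_mul, mul_add, mul_left_comm, mul_assoc,
    mul_left_comm X, mul_right_comm _ _ (letterSeries χ z), mul_comm _ (wordSeries χ (z' :: v))]
  exact (SModEq.rfl.mul hG).add (SModEq.rfl.mul hF)

theorem sum_wordSeries_shuffleList (hM : ∀ n, 0 < n → n < M → IsUnit (n : A))
    {u v : List (WithZero μ)} (hu : u.getLast? ≠ some 0) (hv : v.getLast? ≠ some 0) :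
    ((shuffleList u v).map (wordSeries χ)).sum ≡ wordSeries χ u * wordSeries χ v
      [SMOD Ideal.span {(X : A⟦X⟧) ^ M}] := by
  induction u, v using shuffleList.induct with
  | case1 v => simp [shuffleList, wordSeries, SModEq.refl]
  | case2 z u => simp [shuffleList, wordSeries, SModEq.refl]
  | case3 z u z' v ih₁ ih₂ =>
    have hmem : ∀ w ∈ shuffleList (z :: u) (z' :: v), w.getLast? ≠ some 0 :=
      fun w => getLast?_ne_of_mem_shuffleList hu hv
    simp only [shuffleList, List.forall_mem_append, List.forall_mem_map] at hmem
    simp only [shuffleList, List.map_append, List.sum_append, List.map_map, Function.comp_def]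
    refine smodEq_of_X_mul_derivative_smodEq hM ?_ ?_
    · simp only [map_add, map_mul, constantCoeff_sum_wordSeries_cons,
        constantCoeff_wordSeries_cons, mul_zero, add_zero]
    calc X * derivative A _
      _ ≡ ((shuffleList (z :: u) v).map (wordSeries χ)).sum * letterSeries χ z' +
            ((shuffleList u (z' :: v)).map (wordSeries χ)).sum * letterSeries χ z
          [SMOD Ideal.span {(X : A⟦X⟧) ^ M}] := by
        rw [map_add, mul_add]
        exact (X_mul_derivative_sum_wordSeries_cons χ hM hmem.1).add
          (X_mul_derivative_sum_wordSeries_cons χ hM hmem.2)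
      _ ≡ wordSeries χ (z :: u) * wordSeries χ v * letterSeries χ z' +
            wordSeries χ u * wordSeries χ (z' :: v) * letterSeries χ z
          [SMOD Ideal.span {(X : A⟦X⟧) ^ M}] :=
        ((ih₁ hu (getLast?_ne_of_getLast?_cons_ne hv)).mul .rfl).add
          ((ih₂ (getLast?_ne_of_getLast?_cons_ne hu) hv).mul .rfl)
      _ ≡ X * derivative A (wordSeries χ (z :: u) * wordSeries χ (z' :: v))
          [SMOD Ideal.span {(X : A⟦X⟧) ^ M}] :=
        (X_mul_derivative_wordSeries_cons_mul χ hM hu hv).symm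

end WordSeries

/-! ### Nested sums as entries of products of matrices -/

section Matrices

variable {A : Type*} {μ : Type} [CommRing A]

/-- The diagonal matrix with the entries `1 / n` for `0 ≤ n ≤ M`, where `1 / n = 0` if `n` is not
invertible. -/
def invMatrix (A : Type*) [CommRing A] (M : ℕ) : Matrix (Fin (M + 1)) (Fin (M + 1)) A :=
  diagonal fun n => Ring.inverse ((n : ℕ) : A)

theorem mul_invMatrix_pow_apply {M : ℕ} (K : Matrix (Fin (M + 1)) (Fin (M + 1)) A) (k : ℕ)
    (m n : Fin (M + 1)) : (K * invMatrix A M ^ k) m n = K m n * Ring.inverse ((n : ℕ) : A) ^ k := by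
  rw [invMatrix, diagonal_pow, mul_diagonal, Pi.pow_apply]

variable [Monoid μ] (χ : μ →* A) (M : ℕ)

/-- The matrix with the entries `x ^ (n - m)` for `0 ≤ m < n ≤ M`, and `0` elsewhere. Products of
such matrices and of powers of `invMatrix` generate the nested sums of `truncL`. -/
def stepMatrix (x : μ) : Matrix (Fin (M + 1)) (Fin (M + 1)) A :=
  fun m n => if m < n then χ x ^ ((n : ℕ) - m) else 0

/-- The product of the matrices attached to the columns of an index. Its entry at `(m, n)` is the
sum of the terms of a multiple `L`-value over the chains `m < n₁ < ⋯ < n_r = n`. -/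
def indexMatrix (t : Index μ) : Matrix (Fin (M + 1)) (Fin (M + 1)) A :=
  (t.map fun c => stepMatrix χ M c.1 * invMatrix A M ^ (c.2 : ℕ)).prod

theorem indexMatrix_nil : indexMatrix χ M [] = 1 :=
  rfl

theorem indexMatrix_cons (c : μ × ℕ+) (t : Index μ) :
    indexMatrix χ M (c :: t) =
      stepMatrix χ M c.1 * invMatrix A M ^ (c.2 : ℕ) * indexMatrix χ M t :=
  List.prod_cons

theorem indexMatrix_append (t t' : Index μ) :
    indexMatrix χ M (t ++ t') = indexMatrix χ M t * indexMatrix χ M t' := by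
  simp only [indexMatrix, List.map_append, List.prod_append]

theorem indexMatrix_concat (t : Index μ) (c : μ × ℕ+) :
    indexMatrix χ M (t ++ [c]) =
      indexMatrix χ M t * stepMatrix χ M c.1 * invMatrix A M ^ (c.2 : ℕ) := by
  rw [indexMatrix_append, indexMatrix_cons, indexMatrix_nil, mul_one, mul_assoc]

variable {M}

theorem stepMatrix_last_left (x : μ) (n : Fin (M + 1)) : stepMatrix χ M x (Fin.last M) n = 0 :=
  if_neg (Fin.le_last n).not_gt

theorem indexMatrix_mul_stepMatrix_last_left (t : Index μ) (x : μ) (n : Fin (M + 1)) :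
    (indexMatrix χ M t * stepMatrix χ M x) (Fin.last M) n = 0 := by
  cases t with
  | nil => rw [indexMatrix_nil, one_mul, stepMatrix_last_left]
  | cons c t =>
    simp only [indexMatrix_cons, mul_assoc]
    exact (mul_apply ..).trans
      (sum_eq_zero fun m _ => by rw [stepMatrix_last_left, zero_mul])

theorem sum_strictMono_Ioo_fin_succ {B : Type*} [AddCommMonoid B] {r : ℕ} (a b : ℕ)
    (F : (Fin (r + 1) → ℕ) → B) :
    ∑ n ∈ (Fintype.piFinset fun _ : Fin (r + 1) => Ioo a b) with StrictMono n, F n =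
      ∑ m ∈ Ioo a b, ∑ n ∈ (Fintype.piFinset fun _ : Fin r => Ioo m b) with StrictMono n,
        F (Fin.cons m n) := by
  have cons_mem (m : ℕ) (n : Fin r → ℕ) :
      (Fin.cons m n : Fin (r + 1) → ℕ) ∈
          (Fintype.piFinset fun _ : Fin (r + 1) => Ioo a b).filter StrictMono ↔
        m ∈ Ioo a b ∧ n ∈ (Fintype.piFinset fun _ : Fin r => Ioo m b).filter StrictMono := by
    simp only [mem_filter, Fintype.mem_piFinset, mem_Ioo, Fin.strictMono_cons, Fin.forall_fin_succ,
      Fin.cons_zero, Fin.cons_succ]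
    grind
  rw [sum_sigma']
  refine sum_bij' (fun n _ => ⟨n 0, Fin.tail n⟩) (fun x _ => Fin.cons x.1 x.2) ?_ ?_ ?_ ?_ ?_
  · intro n hn
    rw [← Fin.cons_self_tail n, cons_mem] at hn
    exact mem_sigma.2 hn
  · rintro ⟨m, n⟩ h
    exact (cons_mem m n).2 (mem_sigma.1 h)
  · exact fun n _ => Fin.cons_self_tail n
  · exact fun _ _ => rfl
  · exact fun n _ => by rw [Fin.cons_self_tail]

variable (M) in
/-- The variant of `truncL` in which the sum is over the chains `a < n₁ < ⋯ < n_r < M`. -/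
def truncLFrom (t : Index μ) (a : ℕ) : A :=
  ∑ n ∈ (Fintype.piFinset fun _ : Fin t.length => Ioo a M) with StrictMono n,
    ∏ i : Fin t.length,
      χ (t.get i).1 ^ (n i - (Fin.cons a n : Fin (t.length + 1) → ℕ) i.castSucc) *
        Ring.inverse (n i : A) ^ ((t.get i).2 : ℕ)

theorem truncLFrom_nil (a : ℕ) : truncLFrom χ M [] a = 1 := by
  have unique_chain : (Fintype.piFinset fun _ : Fin ([] : Index μ).length => Ioo a M).filter
      StrictMono = {fun i => i.elim0} :=
    eq_singleton_iff_unique_mem.2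
      ⟨mem_filter.2 ⟨Fintype.mem_piFinset.2 fun i => i.elim0, fun i => i.elim0⟩,
        fun _ _ => funext fun i => i.elim0⟩
  rw [truncLFrom, unique_chain, sum_singleton]
  exact Fin.prod_univ_zero _

theorem truncLFrom_cons (c : μ × ℕ+) (t : Index μ) (a : ℕ) :
    truncLFrom χ M (c :: t) a =
      ∑ m ∈ Ioo a M, χ c.1 ^ (m - a) * Ring.inverse (m : A) ^ (c.2 : ℕ) * truncLFrom χ M t m := by
  simp only [truncLFrom, mul_sum]
  refine (sum_strictMono_Ioo_fin_succ a M _).trans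
    (sum_congr rfl fun m _ => sum_congr rfl fun n _ => ?_)
  exact Fin.prod_univ_succ _

theorem truncLFrom_eq_indexMatrix_mul_stepMatrix (t : Index μ) (a : Fin (M + 1))
    (ha : a < Fin.last M) :
    truncLFrom χ M t a = (indexMatrix χ M t * stepMatrix χ M 1) a (Fin.last M) := by
  induction t generalizing a with
  | nil => rw [truncLFrom_nil, indexMatrix_nil, one_mul, stepMatrix, if_pos ha, map_one, one_pow]
  | cons c t ih =>
    have Ioo_eq_filter : Ioo (a : ℕ) M = (range M).filter fun m => (a : ℕ) < m := by
      ext m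
      simp [and_comm]
    rw [truncLFrom_cons, Ioo_eq_filter, sum_filter, sum_range, indexMatrix_cons, mul_assoc,
      mul_apply, Fin.sum_univ_castSucc, indexMatrix_mul_stepMatrix_last_left, mul_zero, add_zero]
    refine sum_congr rfl fun m _ => ?_
    simp only [← ih m.castSucc m.castSucc_lt_last, mul_invMatrix_pow_apply, stepMatrix, Fin.lt_def,
      Fin.val_castSucc, ite_mul, zero_mul]

theorem truncL_eq_indexMatrix_mul_stepMatrix {A : Type} [CommRing A] (χ : μ →* A) (hM : 0 < M)
    (t : Index μ) :
    truncL χ M t = (indexMatrix χ M t * stepMatrix χ M 1) 0 (Fin.last M) :=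
  truncLFrom_eq_indexMatrix_mul_stepMatrix χ t 0 hM

theorem coeff_mul_letterSeries_coe {F : A⟦X⟧} {K : Matrix (Fin (M + 1)) (Fin (M + 1)) A}
    {a : Fin (M + 1)} (h : ∀ m : Fin (M + 1), coeff m F = K a m) (x : μ) (n : Fin (M + 1)) :
    coeff n (F * letterSeries χ (x : WithZero μ)) = (K * stepMatrix χ M x) a n := by
  rw [coeff_mul, Nat.sum_antidiagonal_eq_sum_range_succ_mk, mul_apply]
  simp only [← h, stepMatrix, coeff_letterSeries_coe, Fin.lt_def]
  rw [← sum_range fun m => coeff m F * if m < (n : ℕ) then χ x ^ ((n : ℕ) - m) else 0]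
  refine sum_subset_zero_on_sdiff (range_subset_range.2 n.2) ?_ ?_
  · intro m hm
    rw [if_neg (by simp only [mem_sdiff, mem_range] at hm; lia), mul_zero]
  · intro m hm
    rcases (mem_range_succ_iff.1 hm).eq_or_lt with rfl | hlt
    · simp
    · rw [if_pos hlt, if_neg (Nat.sub_pos_of_lt hlt).ne']

theorem coeff_wordSeries_replicate_zero_append (k : ℕ) (u : List (WithZero μ)) (n : ℕ) :
    coeff n (wordSeries χ (List.replicate k 0 ++ u)) =
      Ring.inverse (n : A) ^ k * coeff n (wordSeries χ u) := by
  induction k with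
  | zero => simp
  | succ k ih =>
    rw [List.replicate_succ, List.cons_append, coeff_wordSeries_cons, letterSeries_zero, mul_one,
      ih, pow_succ', mul_assoc]

theorem coeff_wordSeries_indexLetters (t : Index μ) (n : Fin (M + 1)) :
    coeff n (wordSeries χ (indexLetters t).reverse) = indexMatrix χ M t 0 n := by
  induction t using List.reverseRecOn generalizing n with
  | nil =>
    rw [indexMatrix_nil, one_apply, indexLetters, List.flatMap_nil, List.reverse_nil, wordSeries,
      coeff_one]
    simp only [Fin.ext_iff, Fin.val_zero, eq_comm]
  | append_singleton t c ih =>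
    have letters_concat : (indexLetters (t ++ [c])).reverse =
        List.replicate ((c.2 : ℕ) - 1) 0 ++ ((c.1 : WithZero μ) :: (indexLetters t).reverse) := by
      simp [indexLetters]
    rw [letters_concat, coeff_wordSeries_replicate_zero_append, coeff_wordSeries_cons, ← mul_assoc,
      pow_sub_one_mul c.2.ne_zero, coeff_mul_letterSeries_coe χ ih, indexMatrix_concat,
      mul_invMatrix_pow_apply, mul_comm]

theorem truncL_eq_coeff {A : Type} [CommRing A] (χ : μ →* A) (hM : 0 < M) (t : Index μ) :
    truncL χ M t =
      coeff M (wordSeries χ (indexLetters t).reverse * letterSeries χ ((1 : μ) : WithZero μ)) := by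
  rw [truncL_eq_indexMatrix_mul_stepMatrix χ hM,
    ← coeff_mul_letterSeries_coe χ (coeff_wordSeries_indexLetters χ t), Fin.val_last]

end Matrices

/-! ### Reflection -/

section Reflection

variable {A : Type*} {μ : Type} [CommRing A] {M : ℕ}

/-- The reflection of a matrix in its antidiagonal. It reverses products, and turns the sum over the
chains `n₁ < ⋯ < n_r` into the sum over the chains `M - n_r < ⋯ < M - n₁`. -/
def reflect :
    Matrix (Fin (M + 1)) (Fin (M + 1)) A →ₗ[A] Matrix (Fin (M + 1)) (Fin (M + 1)) A where
  toFun K := Kᵀ.submatrix Fin.rev Fin.rev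
  map_add' _ _ := rfl
  map_smul' _ _ := rfl

theorem reflect_apply (K : Matrix (Fin (M + 1)) (Fin (M + 1)) A) (m n : Fin (M + 1)) :
    reflect K m n = K n.rev m.rev :=
  rfl

theorem reflect_reflect (K : Matrix (Fin (M + 1)) (Fin (M + 1)) A) : reflect (reflect K) = K := by
  ext m n
  simp only [reflect_apply, Fin.rev_rev]

theorem reflect_mul (K L : Matrix (Fin (M + 1)) (Fin (M + 1)) A) :
    reflect (K * L) = reflect L * reflect K := by
  ext m n
  simp only [reflect_apply, mul_apply, mul_comm (K _ _)]
  exact (Equiv.sum_comp Fin.revPerm fun i => L i m.rev * K n.rev i).symm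

theorem reflect_diagonal (d : Fin (M + 1) → A) :
    reflect (diagonal d) = diagonal fun n => d n.rev := by
  ext m n
  rcases eq_or_ne m n with rfl | h
  · rw [reflect_apply, diagonal_apply_eq, diagonal_apply_eq]
  · rw [reflect_apply, diagonal_apply_ne _ (Fin.rev_injective.ne h.symm), diagonal_apply_ne _ h]

theorem reflect_pow (K : Matrix (Fin (M + 1)) (Fin (M + 1)) A) (k : ℕ) :
    reflect (K ^ k) = reflect K ^ k := by
  induction k with
  | zero => simpa using reflect_diagonal (1 : Fin (M + 1) → A)
  | succ k ih => rw [pow_succ, reflect_mul, ih, pow_succ']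

theorem coeff_mul_eq_mul_reflect {F G : A⟦X⟧} {K L : Matrix (Fin (M + 1)) (Fin (M + 1)) A}
    (hF : ∀ n : Fin (M + 1), coeff n F = K 0 n) (hG : ∀ n : Fin (M + 1), coeff n G = L 0 n) :
    coeff M (F * G) = (K * reflect L) 0 (Fin.last M) := by
  rw [coeff_mul, Nat.sum_antidiagonal_eq_sum_range_succ_mk, sum_range, mul_apply]
  refine sum_congr rfl fun i _ => ?_
  rw [reflect_apply, ← hF, Fin.rev_last, ← hG, Fin.val_rev, Nat.succ_sub_succ]

theorem coeff_eq_of_smodEq {F G H : A⟦X⟧} (hH : constantCoeff H = 0)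
    (h : F ≡ G [SMOD Ideal.span {(X : A⟦X⟧) ^ M}]) : coeff M (F * H) = coeff M (G * H) := by
  obtain ⟨Q, hQ⟩ := Ideal.mem_span_singleton.1 (SModEq.sub_mem.1 h)
  rw [← sub_eq_zero, ← map_sub, ← sub_mul, hQ, mul_assoc, coeff_X_pow_mul', if_pos le_rfl,
    Nat.sub_self, coeff_zero_eq_constantCoeff_apply, map_mul, hH, mul_zero]

/-- The index with the columns `(ξ₂, m₁), …, (ξ_s, m_{s-1}), (x, m_s)` in reverse order, which
reflection attaches to the columns `(ξ₁, m₁), …, (ξ_s, m_s)` and a last step of color `x`. -/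
def reversedIndex {s : ℕ} (ξ : Fin (s + 1) → μ) (m : Fin (s + 1) → ℕ+) (x : μ) : Index μ :=
  (List.ofFn fun j => ((Fin.snoc (fun i : Fin s => ξ i.succ) x : Fin (s + 1) → μ) j, m j)).reverse

section Monoid

variable [Monoid μ] (χ : μ →* A)

theorem reflect_stepMatrix (x : μ) : reflect (stepMatrix χ M x) = stepMatrix χ M x := by
  ext m n
  simp only [reflect_apply, stepMatrix, Fin.rev_lt_rev, Fin.val_rev]
  congr 2
  lia

theorem sum_truncL_shuffleList {A : Type} [CommRing A] (χ : μ →* A) (h₀ : 0 < M)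
    (hM : ∀ n, 0 < n → n < M → IsUnit (n : A)) (t t' : Index μ) :
    ((shuffleList (indexLetters t).reverse (indexLetters t').reverse).map fun w =>
        truncL χ M (parse w.reverse).2).sum =
      (indexMatrix χ M t * reflect (indexMatrix χ M t' * stepMatrix χ M 1)) 0 (Fin.last M) := by
  set L := shuffleList (indexLetters t).reverse (indexLetters t').reverse
  set ω := letterSeries χ ((1 : μ) : WithZero μ) with hω
  have constantCoeff_ω : constantCoeff ω = 0 := by
    rw [← coeff_zero_eq_constantCoeff_apply, hω, coeff_letterSeries_coe, if_pos rfl]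
  have truncL_parse (w) (hw : w ∈ L) :
      truncL χ M (parse w.reverse).2 = coeff M (wordSeries χ w * ω) := by
    have h := indexLetters_parse w.reverse
    rw [parse_fst_of_mem_shuffleList hw, List.replicate_zero, List.nil_append] at h
    rw [truncL_eq_coeff χ h₀, h, List.reverse_reverse]
  calc (L.map fun w => truncL χ M (parse w.reverse).2).sum
    _ = coeff M ((L.map (wordSeries χ)).sum * ω) := by
      rw [List.map_congr_left truncL_parse, ← List.sum_map_mul_right, map_list_sum, List.map_map,
        Function.comp_def]
    _ = coeff M (wordSeries χ (indexLetters t).reverse *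
          (wordSeries χ (indexLetters t').reverse * ω)) := by
      rw [← mul_assoc]
      exact coeff_eq_of_smodEq constantCoeff_ω (sum_wordSeries_shuffleList χ hM
        (getLast?_reverse_indexLetters t) (getLast?_reverse_indexLetters t'))
    _ = _ := coeff_mul_eq_mul_reflect (coeff_wordSeries_indexLetters χ t)
      (coeff_mul_letterSeries_coe χ (coeff_wordSeries_indexLetters χ t') 1)

theorem reflect_prod_stepMatrix_mul {s : ℕ} (ξ : Fin (s + 1) → μ) (m : Fin (s + 1) → ℕ+) (x : μ) :
    reflect ((List.ofFn fun j => stepMatrix χ M (ξ j) * reflect (invMatrix A M) ^ (m j : ℕ)).prod *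
        stepMatrix χ M x) =
      indexMatrix χ M (reversedIndex ξ m x) * stepMatrix χ M (ξ 0) := by
  unfold reversedIndex
  induction s with
  | zero =>
    simp [indexMatrix, reflect_mul, reflect_pow, reflect_reflect, reflect_stepMatrix, mul_assoc,
      Fin.snoc]
  | succ s ih =>
    have snoc_zero : (Fin.snoc (fun i : Fin (s + 1) => ξ i.succ) x : Fin (s + 2) → μ) 0 = ξ 1 :=
      Fin.snoc_castSucc (α := fun _ => μ) x (fun i : Fin (s + 1) => ξ i.succ) 0
    have snoc_succ (j : Fin (s + 1)) :
        (Fin.snoc (fun i : Fin (s + 1) => ξ i.succ) x : Fin (s + 2) → μ) j.succ =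
          (Fin.snoc (fun i : Fin s => ξ i.succ.succ) x : Fin (s + 1) → μ) j := by
      refine Fin.lastCases ?_ (fun j => ?_) j
      · rw [Fin.succ_last, Fin.snoc_last, Fin.snoc_last]
      · rw [Fin.succ_castSucc, Fin.snoc_castSucc, Fin.snoc_castSucc]
    rw [List.ofFn_succ, List.prod_cons, mul_assoc, reflect_mul, ih, reflect_mul, reflect_pow,
      reflect_reflect, reflect_stepMatrix]
    conv_rhs => rw [List.ofFn_succ, List.reverse_cons, indexMatrix_concat, snoc_zero]
    simp only [snoc_succ, mul_assoc, Fin.succ_zero_eq_one]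

end Monoid

/-- The matrix that twists the colors of an index: conjugation by it divides them by `y`. -/
def twistMatrix [Monoid μ] (χ : μ →* A) (M : ℕ) (y : μ) : Matrix (Fin (M + 1)) (Fin (M + 1)) A :=
  diagonal fun n => χ y ^ (n : ℕ)

section Group

variable [Group μ] (χ : μ →* A)

theorem semiconjBy_twistMatrix_stepMatrix (x y : μ) :
    SemiconjBy (twistMatrix χ M y) (stepMatrix χ M x) (stepMatrix χ M (x / y)) := by
  ext m n
  rw [twistMatrix, diagonal_mul, mul_diagonal, stepMatrix, stepMatrix]
  split_ifs with h
  · rw [← Nat.add_sub_of_le (Fin.le_def.1 h.le), pow_add, Nat.add_sub_cancel_left, mul_left_comm,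
      ← mul_pow, ← map_mul, div_mul_cancel]
  · rw [mul_zero, zero_mul]

theorem semiconjBy_twistMatrix_indexMatrix (y : μ) (t : Index μ) :
    SemiconjBy (twistMatrix χ M y) (indexMatrix χ M t)
      (indexMatrix χ M (t.map fun c => (c.1 / y, c.2))) := by
  induction t with
  | nil => exact SemiconjBy.one_right _
  | cons c t ih =>
    have twist_inv : Commute (twistMatrix χ M y) (invMatrix A M) := commute_diagonal _ _
    rw [List.map_cons, indexMatrix_cons, indexMatrix_cons]
    exact ((semiconjBy_twistMatrix_stepMatrix χ c.1 y).mul_right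
      (twist_inv.pow_right _)).mul_right ih

theorem indexMatrix_mul_stepMatrix_apply_last {A : Type} [CommRing A] (χ : μ →* A) (hM : 0 < M)
    (t : Index μ) (y : μ) :
    (indexMatrix χ M t * stepMatrix χ M y) 0 (Fin.last M) =
      χ y ^ M * truncL χ M (t.map fun c => (c.1 / y, c.2)) := by
  have h := ((semiconjBy_twistMatrix_indexMatrix χ (M := M) y t).mul_right
    (semiconjBy_twistMatrix_stepMatrix χ y y)).eq
  have entry := congrFun₂ h 0 (Fin.last M)
  rwa [div_self', twistMatrix, diagonal_mul, mul_diagonal, Fin.val_zero, pow_zero, one_mul,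
    ← truncL_eq_indexMatrix_mul_stepMatrix χ hM, mul_comm, Fin.val_last] at entry

end Group

end Reflection

/-! ### Expansion of `1 / (p - n)` in powers of `p` -/

section Expansion

variable {A : Type*} {μ : Type} [CommRing A]

theorem one_sub_mul_sum_choose (y : A) (d n : ℕ) :
    (1 - y) * ∑ f ∈ range n, ((d + 1 + f).choose f : A) * y ^ f =
      ∑ f ∈ range n, ((d + f).choose f : A) * y ^ f - ((d + n).choose (d + 1) : A) * y ^ n := by
  induction n with
  | zero => simp
  | succ n ih =>
    have pascal : (d + 1 + n).choose n = (d + n).choose n + (d + n).choose (d + 1) := by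
      rw [← Nat.choose_symm_add, ← Nat.choose_symm_add (a := d), add_right_comm,
        Nat.choose_succ_succ]
    have symm : (d + (n + 1)).choose (d + 1) = (d + 1 + n).choose n := by
      rw [← Nat.choose_symm_add, add_right_comm, add_assoc]
    rw [sum_range_succ, sum_range_succ, mul_add, ih, symm, pascal]
    push_cast
    ring

theorem one_sub_pow_mul_sum_choose {y : A} {n : ℕ} (hy : y ^ n = 0) (d : ℕ) :
    (1 - y) ^ (d + 1) * ∑ f ∈ range n, ((d + f).choose f : A) * y ^ f = 1 := by
  induction d with
  | zero => simpa [hy] using mul_neg_geom_sum y n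
  | succ d ih => rw [pow_succ, mul_assoc, one_sub_mul_sum_choose, hy, mul_zero, sub_zero, ih]

theorem pow_eq_sum_of_mul_one_sub_eq_neg {p v w : A} {n : ℕ} (hp : p ^ n = 0)
    (h : v * (1 - p * w) = -w) (l : ℕ+) :
    v ^ (l : ℕ) = ∑ f ∈ range n,
      (-1) ^ (l : ℕ) * ((l + f - 1).choose f : A) * p ^ f * w ^ (l + f : ℕ) := by
  obtain ⟨d, hd⟩ := Nat.exists_eq_succ_of_ne_zero l.ne_zero
  have hy : (p * w) ^ n = 0 := by rw [mul_pow, hp, zero_mul]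
  simp only [hd, Nat.succ_eq_add_one, Nat.add_right_comm d 1, Nat.add_sub_cancel]
  calc v ^ (d + 1)
    _ = (v * (1 - p * w)) ^ (d + 1) *
          ∑ f ∈ range n, ((d + f).choose f : A) * (p * w) ^ f := by
      rw [mul_pow, mul_assoc, one_sub_pow_mul_sum_choose hy, mul_one]
    _ = _ := by
      rw [h, mul_sum]
      refine sum_congr rfl fun f _ => ?_
      rw [neg_pow]
      ring

variable {p n : ℕ}

theorem inverse_natCast_mul_one_sub (hp : (p : A) ^ n = 0)
    (hu : ∀ m, 0 < m → m < p → IsUnit (m : A)) {m : ℕ} (hm : m ≤ p) :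
    Ring.inverse (m : A) * (1 - p * Ring.inverse ((p - m : ℕ) : A)) =
      -Ring.inverse ((p - m : ℕ) : A) := by
  nontriviality A
  have inverse_p : Ring.inverse (p : A) = 0 :=
    Ring.inverse_non_unit _ (IsNilpotent.not_isUnit ⟨n, hp⟩)
  rcases m.eq_zero_or_pos with rfl | h₀
  · simp [inverse_p]
  rcases hm.eq_or_lt with rfl | hlt
  · simp [inverse_p]
  have hv := Ring.inverse_mul_cancel _ (hu m h₀ hlt)
  have hw := Ring.mul_inverse_cancel _ (hu (p - m) (Nat.sub_pos_of_lt hlt) (Nat.sub_lt_self h₀ hm))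
  rw [Nat.cast_sub hm] at hw ⊢
  linear_combination (-Ring.inverse (m : A)) * hw - Ring.inverse ((p : A) - m) * hv

theorem invMatrix_pow_eq_sum (hp : (p : A) ^ n = 0)
    (hu : ∀ m, 0 < m → m < p → IsUnit (m : A)) (l : ℕ+) :
    invMatrix A p ^ (l : ℕ) = ∑ f ∈ range n,
      ((-1) ^ (l : ℕ) * ((l + f - 1).choose f : A) * p ^ f) •
        reflect (invMatrix A p) ^ (l + f : ℕ) := by
  simp only [invMatrix, reflect_diagonal, diagonal_pow, ← diagonal_smul]
  ext i j
  rw [Matrix.sum_apply]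
  rcases eq_or_ne i j with rfl | hij
  · simp only [diagonal_apply_eq, Pi.smul_apply, Pi.pow_apply, smul_eq_mul, Fin.val_rev,
      Nat.add_sub_add_right]
    exact pow_eq_sum_of_mul_one_sub_eq_neg hp
      (inverse_natCast_mul_one_sub hp hu (Nat.lt_succ_iff.1 i.2)) l
  · simp only [diagonal_apply_ne _ hij, sum_const_zero]

theorem prod_ofFn_sum_smul {A B κ : Type*} [CommSemiring A] [Semiring B] [Algebra A B] {s : ℕ}
    (T : Finset κ) (c : Fin s → κ → A) (g : Fin s → κ → B) :
    (List.ofFn fun j => ∑ f ∈ T, c j f • g j f).prod =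
      ∑ f ∈ Fintype.piFinset fun _ : Fin s => T,
        (∏ j, c j (f j)) • (List.ofFn fun j => g j (f j)).prod := by
  have expand := (MultilinearMap.mkPiAlgebraFin A s B).map_sum_finset
    (fun j f => c j f • g j f) fun _ => T
  simpa only [MultilinearMap.map_smul_univ, MultilinearMap.mkPiAlgebraFin_apply] using expand

variable [Group μ] (χ : μ →* A)

theorem reflect_indexMatrix_mul_stepMatrix_one (hp : (p : A) ^ n = 0)
    (hu : ∀ m, 0 < m → m < p → IsUnit (m : A)) {s : ℕ} (ξ : Fin (s + 1) → μ)
    (l : Fin (s + 1) → ℕ+) :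
    reflect (indexMatrix χ p (List.ofFn fun j => (ξ j, l j)) * stepMatrix χ p 1) =
      ∑ f ∈ Fintype.piFinset fun _ : Fin (s + 1) => range n,
        (∏ j, ((-1) ^ (l j : ℕ) * ((l j + f j - 1).choose (f j) : A) * p ^ f j)) •
          (indexMatrix χ p
              (reversedIndex ξ (fun j => ⟨l j + f j, Nat.add_pos_left (l j).pos _⟩) 1) *
            stepMatrix χ p (ξ 0)) := by
  have indexMatrix_eq : indexMatrix χ p (List.ofFn fun j => (ξ j, l j)) =
      ∑ f ∈ Fintype.piFinset fun _ : Fin (s + 1) => range n,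
        (∏ j, ((-1) ^ (l j : ℕ) * ((l j + f j - 1).choose (f j) : A) * p ^ f j)) •
          (List.ofFn fun j =>
            stepMatrix χ p (ξ j) * reflect (invMatrix A p) ^ (l j + f j : ℕ)).prod := by
    simp only [indexMatrix, List.map_ofFn, Function.comp_def, invMatrix_pow_eq_sum hp hu, mul_sum,
      mul_smul_comm]
    exact prod_ofFn_sum_smul (range n) _ _
  rw [indexMatrix_eq, sum_mul, map_sum]
  refine sum_congr rfl fun f _ => ?_
  rw [smul_mul_assoc, map_smul]
  exact congrArg _ (reflect_prod_stepMatrix_mul χ ξ (fun j => ⟨l j + f j, _⟩) 1)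

theorem reflectedIndex_eq_map {r s : ℕ} (η : Fin r → μ) (k : Fin r → ℕ+) (ξ : Fin (s + 1) → μ)
    (l : Fin (s + 1) → ℕ+) (f : Fin (s + 1) → ℕ) :
    reflectedIndex η k ξ l f =
      ((List.ofFn fun i => (η i, k i)) ++
        reversedIndex ξ (fun j => ⟨l j + f j, Nat.add_pos_left (l j).pos _⟩) 1).map
          fun c => (c.1 / ξ 0, c.2) := by
  simp only [reflectedIndex, reversedIndex, List.map_append, List.map_reverse, List.map_ofFn,
    Function.comp_def]

theorem sum_truncL_shuffleList_eq_sum_reflectedIndex {A : Type} [CommRing A] (χ : μ →* A)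
    (h₀ : 0 < p) (hp : (p : A) ^ n = 0)
    (hu : ∀ m, 0 < m → m < p → IsUnit (m : A)) {r s : ℕ} (η : Fin r → μ) (k : Fin r → ℕ+)
    (ξ : Fin (s + 1) → μ) (l : Fin (s + 1) → ℕ+) :
    ((shuffleList (indexLetters (List.ofFn fun i => (η i, k i))).reverse
          (indexLetters (List.ofFn fun j => (ξ j, l j))).reverse).map fun w =>
        truncL χ p (parse w.reverse).2).sum =
      (-1) ^ (∑ i, (l i : ℕ)) * χ (ξ 0) ^ p *
        ∑ f ∈ Fintype.piFinset fun _ : Fin (s + 1) => range n,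
          (∏ i, ((l i + f i - 1).choose (f i) : A)) * truncL χ p (reflectedIndex η k ξ l f) *
            (p : A) ^ ∑ i, f i := by
  rw [sum_truncL_shuffleList χ h₀ hu, reflect_indexMatrix_mul_stepMatrix_one χ hp hu, mul_sum,
    Matrix.sum_apply, mul_sum]
  refine sum_congr rfl fun f _ => ?_
  rw [mul_smul_comm, ← mul_assoc, ← indexMatrix_append, Matrix.smul_apply,
    indexMatrix_mul_stepMatrix_apply_last χ h₀, ← reflectedIndex_eq_map, smul_eq_mul,
    prod_mul_distrib, prod_mul_distrib, prod_pow_eq_pow_sum, prod_pow_eq_pow_sum]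
  ring

end Expansion

/-! ### Series in `𝒜̂` -/

section Hat

variable {R ι : Type} [CommRing R] (a : ι → R)

/-- The natural projection `𝒜̂ → 𝒜ₙ`. -/
def hatEval (n : ℕ+) : AdelicHat a →+* AdelicLevel a n :=
  (Pi.evalRingHom _ n).comp (AdelicHat a).subtype

theorem continuous_hatEval (n : ℕ+) : Continuous (hatEval a n) :=
  (continuous_apply n).comp continuous_subtype_val

variable {a}

theorem levelTransition_hatEval {m n : ℕ+} (h : m ≤ n) (x : AdelicHat a) :
    levelTransition a h (hatEval a n x) = hatEval a m x :=
  x.2 m n h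

theorem hat_ext {x y : AdelicHat a} (h : ∀ n, hatEval a n x = hatEval a n y) : x = y :=
  Subtype.ext (funext h)

theorem hatEval_toHat_congr {n : ℕ+} {x y : ∀ i, AdicCompletion (Ideal.span {a i}) R}
    (h : ∀ i, AdicCompletion.evalₐ (Ideal.span {a i}) n (x i) =
      AdicCompletion.evalₐ (Ideal.span {a i}) n (y i)) :
    hatEval a n (toHat a x) = hatEval a n (toHat a y) :=
  congrArg (levelMk a n) (funext h)

theorem summable_hat_iff {κ : Type*} {F : κ → AdelicHat a} :
    Summable F ↔ ∀ n, Summable fun f => hatEval a n (F f) := by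
  refine ⟨fun h n => h.map (hatEval a n) (continuous_hatEval a n), fun h => ?_⟩
  have compatible (m n : ℕ+) (hmn : m ≤ n) :
      levelTransition a hmn (∑' f, hatEval a n (F f)) = ∑' f, hatEval a m (F f) := by
    rw [(h n).map_tsum _ continuous_of_discreteTopology]
    simp only [levelTransition_hatEval]
  refine ⟨⟨fun n => ∑' f, hatEval a n (F f), compatible⟩, ?_⟩
  exact (Topology.IsInducing.subtypeVal.hasSum_iff (g := (AdelicHat a).subtype) F _).1
    (Pi.hasSum.2 fun n => (h n).hasSum)

end Hat

/-! ### The shuffle relation in `𝒜̂(N;α)` -/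

section LValues

theorem map_truncL {A B μ : Type} [CommRing A] [CommRing B] [Monoid μ] (χ : μ →* A) (φ : A →+* B)
    {M : ℕ} (hM : ∀ n, 0 < n → n < M → IsUnit (n : A)) (t : Index μ) :
    φ (truncL χ M t) = truncL ((φ : A →* B).comp χ) M t := by
  simp only [truncL, map_sum, map_prod, map_mul, map_pow]
  refine sum_congr rfl fun n hn => prod_congr rfl fun i _ => ?_
  have hi := mem_Ioo.1 (Fintype.mem_piFinset.1 (mem_filter.1 hn).1 i)
  have map_inverse : φ (Ring.inverse (n i : A)) = Ring.inverse (n i : B) := by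
    obtain ⟨u, hu⟩ := hM _ hi.1 hi.2
    rw [← map_natCast φ, ← hu, Ring.inverse_unit]
    exact (Ring.inverse_unit (u.map (φ : A →* B))).symm
  rw [map_inverse]
  rfl

variable {N : ℕ} {α : ZMod N}

theorem natCast_pow_quotient_eq_zero (N p n : ℕ) :
    (p : CycRing N ⧸ Ideal.span {(p : CycRing N)} ^ n) ^ n = 0 := by
  rw [← map_natCast (Ideal.Quotient.mk _), ← map_pow]
  exact Ideal.Quotient.eq_zero_iff_mem.2
    (Ideal.pow_mem_pow (Ideal.mem_span_singleton_self _) n)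

theorem isUnit_natCast_padic_of_lt (N : ℕ) {p m : ℕ} (hp : p.Prime) (h₀ : 0 < m) (hm : m < p) :
    IsUnit (m : PAdic N p) :=
  isUnit_natCast_padic N p m (Nat.coprime_of_lt_prime h₀.ne' hm hp).symm

theorem hatEval_bigPrime_pow_eq_zero {n : ℕ+} {m : ℕ} (h : (n : ℕ) ≤ m) :
    hatEval (primeFamily N α) n (bigPrime N α ^ m) = 0 := by
  rw [bigPrime, ← map_pow, proj, ← map_zero (hatEval (primeFamily N α) n),
    ← map_zero (toHat (primeFamily N α))]
  refine hatEval_toHat_congr fun p => ?_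
  rw [Pi.pow_apply, Pi.zero_apply, map_pow, map_natCast, map_zero]
  exact pow_eq_zero_of_le h (natCast_pow_quotient_eq_zero N p n)

variable [NeZero N] (ζ : rootsOfUnity N ℂ) (hζ : IsPrimitiveRoot ζ N)

theorem LHatLin_indexShuffle_single (t t' : Index (rootsOfUnity N ℂ)) :
    LHatLin N α ζ hζ (indexShuffle (Finsupp.single t 1) (Finsupp.single t' 1)) =
      proj N α fun p => ((shuffleList (indexLetters t).reverse (indexLetters t').reverse).map
        fun w => truncL (muPAdic N ζ hζ p.1) p.1 (parse w.reverse).2).sum := by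
  rw [indexShuffle_single_single, map_list_sum, List.map_map, Function.comp_def]
  simp only [LHatLin, Finsupp.linearCombination_single, one_smul, LHat]
  rw [← Function.comp_def (proj N α), ← List.map_map, ← map_list_sum]
  congr 1
  ext1 p
  rw [Pi.list_sum_apply, List.map_map, Function.comp_def]

theorem evalₐ_sum_truncL_shuffleList {p n : ℕ} (hp : p.Prime) {r s : ℕ}
    (η : Fin r → rootsOfUnity N ℂ) (k : Fin r → ℕ+)
    (ξ : Fin (s + 1) → rootsOfUnity N ℂ) (l : Fin (s + 1) → ℕ+) :
    AdicCompletion.evalₐ (Ideal.span {(p : CycRing N)}) n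
        ((shuffleList (indexLetters (List.ofFn fun i => (η i, k i))).reverse
            (indexLetters (List.ofFn fun j => (ξ j, l j))).reverse).map fun w =>
          truncL (muPAdic N ζ hζ p) p (parse w.reverse).2).sum =
      AdicCompletion.evalₐ (Ideal.span {(p : CycRing N)}) n
        ((-1) ^ (∑ i, (l i : ℕ)) * muPAdic N ζ hζ p (ξ 0) ^ p *
          ∑ f ∈ Fintype.piFinset fun _ : Fin (s + 1) => range n,
            (∏ i, ((l i + f i - 1).choose (f i) : PAdic N p)) *
              truncL (muPAdic N ζ hζ p) p (reflectedIndex η k ξ l f) *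
                (p : PAdic N p) ^ ∑ i, f i) := by
  set φ := (AdicCompletion.evalₐ (Ideal.span {(p : CycRing N)}) n).toRingHom
  have isUnit_padic (m : ℕ) := isUnit_natCast_padic_of_lt N (m := m) hp
  have isUnit_quotient (m : ℕ) (h₀ : 0 < m) (hm : m < p) :
      IsUnit (m : CycRing N ⧸ Ideal.span {(p : CycRing N)} ^ n) := by
    simpa using (isUnit_padic m h₀ hm).map φ
  have key := sum_truncL_shuffleList_eq_sum_reflectedIndex
    ((φ : PAdic N p →* _).comp (muPAdic N ζ hζ p)) hp.pos (natCast_pow_quotient_eq_zero N p n)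
    isUnit_quotient η k ξ l
  change φ _ = φ _
  simp only [map_list_sum, List.map_map, Function.comp_def, map_mul, map_sum, map_prod, map_pow,
    map_neg, map_one, map_natCast, map_truncL _ φ isUnit_padic]
  exact key

theorem hatEval_LHatLin_indexShuffle {r s : ℕ} (η : Fin r → rootsOfUnity N ℂ) (k : Fin r → ℕ+)
    (ξ : Fin (s + 1) → rootsOfUnity N ℂ) (l : Fin (s + 1) → ℕ+) (n : ℕ+) :
    hatEval (primeFamily N α) n (LHatLin N α ζ hζ (indexShuffle
        (Finsupp.single (List.ofFn fun i => (η i, k i)) 1)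
        (Finsupp.single (List.ofFn fun j => (ξ j, l j)) 1))) =
      hatEval (primeFamily N α) n ((-1) ^ (∑ i, (l i : ℕ)) * powBigPrime N α ζ hζ (ξ 0) *
        ∑ f ∈ Fintype.piFinset fun _ : Fin (s + 1) => range n,
          (∏ i, ((l i + f i - 1).choose (f i) : AHat N α)) *
            LHat N α ζ hζ (reflectedIndex η k ξ l f) * bigPrime N α ^ ∑ i, f i) := by
  simp only [LHatLin_indexShuffle_single, powBigPrime, LHat, bigPrime, ← map_natCast (proj N α),
    ← map_one (proj N α), ← map_neg, ← map_pow, ← map_prod, ← map_mul, ← map_sum]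
  refine hatEval_toHat_congr fun p => (evalₐ_sum_truncL_shuffleList ζ hζ p.2.1 η k ξ l).trans ?_
  simp

end LValues

end FiniteMLV

end

theorem mainTheorem4 (N : ℕ) [NeZero N] (α : ZMod N)
    (ζ : rootsOfUnity N ℂ) (hζ : IsPrimitiveRoot ζ N)
    (r s : ℕ) (k : Fin r → ℕ+) (l : Fin (s + 1) → ℕ+)
    (η : Fin r → rootsOfUnity N ℂ) (ξ : Fin (s + 1) → rootsOfUnity N ℂ) :
    Summable (fun f : Fin (s + 1) → ℕ =>
      (∏ i, ((l i + f i - 1).choose (f i) : FiniteMLV.AHat N α)) *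
        FiniteMLV.LHat N α ζ hζ (FiniteMLV.reflectedIndex η k ξ l f) *
        FiniteMLV.bigPrime N α ^ ∑ i, f i) ∧
    FiniteMLV.LHatLin N α ζ hζ
        (FiniteMLV.indexShuffle
          (Finsupp.single (List.ofFn fun i => (η i, k i)) 1)
          (Finsupp.single (List.ofFn fun j => (ξ j, l j)) 1)) =
      (-1) ^ (∑ i, (l i : ℕ)) * FiniteMLV.powBigPrime N α ζ hζ (ξ 0) *
        ∑' f : Fin (s + 1) → ℕ,
          (∏ i, ((l i + f i - 1).choose (f i) : FiniteMLV.AHat N α)) *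
            FiniteMLV.LHat N α ζ hζ (FiniteMLV.reflectedIndex η k ξ l f) *
            FiniteMLV.bigPrime N α ^ ∑ i, f i := by
  have vanish (n : ℕ+) (f) (hf : f ∉ Fintype.piFinset fun _ : Fin (s + 1) => Finset.range n) :
      FiniteMLV.hatEval (FiniteMLV.primeFamily N α) n
        ((∏ i, ((l i + f i - 1).choose (f i) : FiniteMLV.AHat N α)) *
          FiniteMLV.LHat N α ζ hζ (FiniteMLV.reflectedIndex η k ξ l f) *
          FiniteMLV.bigPrime N α ^ ∑ i, f i) = 0 := by
    simp only [Fintype.mem_piFinset, Finset.mem_range, not_forall, not_lt] at hf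
    obtain ⟨i, hi⟩ := hf
    rw [map_mul, FiniteMLV.hatEval_bigPrime_pow_eq_zero
      (hi.trans (Finset.single_le_sum_of_canonicallyOrdered (Finset.mem_univ i))), mul_zero]
  have summable := FiniteMLV.summable_hat_iff.2 fun n => summable_of_ne_finset_zero (vanish n)
  refine ⟨summable, FiniteMLV.hat_ext fun n => ?_⟩
  rw [FiniteMLV.hatEval_LHatLin_indexShuffle, map_mul, map_mul _ _ (tsum _),
    summable.map_tsum _ (FiniteMLV.continuous_hatEval _ n), tsum_eq_sum (vanish n), map_sum]
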